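/- **Proposition 3.14.** Let $n$ be a natural number, let $A, B, X$ be $n\times n$ complex matrices with $A$ and $B$ positive semidefinite, and let $|||\cdot|||$ be a unitarily invariant norm on the $n\times n$ complex matrices, that is, a norm with $|||UMV|||=|||M|||$ for all matrices $M$ and all unitary matrices $U,V$. Let $0<\nu\le\frac12$, $r=\min\{\nu,1-\nu\}$ and $r_0=\min\{2r,1-2r\}$. Then $$\begin{aligned} |||A^{1-\nu}XB^{\nu}+A^{\nu}XB^{1-\nu}||| \le{}& (1-2\nu)\bigl(|||AX|||+|||XB|||\bigr)+\Bigl(2\bigl(2\nu\sqrt{|||AX|||\,|||XB|||}\bigr)\\ &-r_0\Bigl(\bigl(\sqrt{|||AX|||}-\sqrt[4]{|||AX|||\,|||XB|||}\bigr)^2+\bigl(\sqrt{|||XB|||}-\sqrt[4]{|||AX|||\,|||XB|||}\bigr)^2\Bigr)\Bigr), \end{aligned}$$ where the powers $A^t$, $B^t$ are those of the functional calculus for positive semidefinite matrices. -/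

import Mathlib

open scoped ComplexOrder

/-- The real power `A ^ t` of a positive semidefinite matrix `A`, by the spectral functional
calculus: the function `x ↦ x ^ t` is applied to the eigenvalues of `A`. -/
noncomputable def matrixRpow {n : ℕ} (A : Matrix (Fin n) (Fin n) ℂ) (t : ℝ) :
    Matrix (Fin n) (Fin n) ℂ :=
  cfc (fun x : ℝ => x ^ t) A

/-- `N` is a unitarily invariant norm on the `n × n` complex matrices: a seminorm (nonnegative,
absolutely homogeneous, subadditive) that vanishes only at `0`, with `N (U * M * V) = N M` for all
matrices `M` and all unitary matrices `U`, `V`. -/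
structure IsUnitarilyInvariantNorm {n : ℕ} (N : Seminorm ℂ (Matrix (Fin n) (Fin n) ℂ)) :
    Prop where
  eq_zero : ∀ M : Matrix (Fin n) (Fin n) ℂ, N M = 0 → M = 0
  unitary_mul_mul : ∀ M : Matrix (Fin n) (Fin n) ℂ,
    ∀ U ∈ Matrix.unitaryGroup (Fin n) ℂ, ∀ V ∈ Matrix.unitaryGroup (Fin n) ℂ,
      N (U * M * V) = N M

/-! The triangle inequality separates the two summands. Three lines applied to `A^(1-z) X B^z` gives
`N (A^(1-t) X B^t) ≤ a^(1-t) b^t`, where `a = N (A X)` and `b = N (X B)`; take `t = ν` and `t = 1 -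
ν` (`matrixRpow_mul_mul_le`). The rest is scalar: since `a^(1-ν) b^ν = a^(1-2ν) √(ab)^(2ν)`, refined
Young with weight `2ν` applies to `a, √(ab)`, and likewise to `b, √(ab)`. -/

open Complex Complex.HadamardThreeLines in
/-- Three lines theorem for a finite sum of bounded entire coefficients times constant vectors. -/
lemma Seminorm.sum_smul_le_interp {E ι : Type*} [AddCommGroup E] [Module ℂ E] [Fintype ι]
    (N : Seminorm ℂ E) (hN : ∀ x, N x = 0 → x = 0) (c : ι → ℂ → ℂ) (m : ι → E) (C : ι → ℝ)
    (hd : ∀ i, Differentiable ℂ (c i))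
    (hC : ∀ i, ∀ z ∈ verticalClosedStrip 0 1, ‖c i z‖ ≤ C i) {a b t : ℝ} (ht : t ∈ Set.Icc 0 1)
    (ha : ∀ z : ℂ, z.re = 0 → N (∑ i, c i z • m i) ≤ a)
    (hb : ∀ z : ℂ, z.re = 1 → N (∑ i, c i z • m i) ≤ b) :
    N (∑ i, c i t • m i) ≤ a ^ (1 - t) * b ^ t := by
  -- `N` becomes the norm of `E`, so that the vector-valued three lines theorem applies.
  let _ : Norm E := ⟨N⟩
  have core : NormedSpace.Core ℂ E :=
    { norm_nonneg := fun x => apply_nonneg N x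
      norm_smul := fun k x => map_smul_eq_mul N k x
      norm_triangle := fun x y => map_add_le_add N x y
      norm_eq_zero_iff := fun x => ⟨hN x, fun h => by subst h; exact map_zero N⟩ }
  let _ : NormedAddCommGroup E := .ofCore core
  let _ : NormedSpace ℂ E := .ofCore core
  have key := norm_le_interp_of_mem_verticalClosedStrip₀₁' (fun z => ∑ i, c i z • m i)
    (z := (t : ℂ)) (a := a) (b := b) (by simpa [verticalClosedStrip] using ht)
    (Differentiable.diffContOnCl (by fun_prop))
    (by
      refine ⟨∑ i, C i * ‖m i‖, ?_⟩
      rintro _ ⟨z, hz, rfl⟩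
      refine (norm_sum_le _ _).trans (Finset.sum_le_sum fun i _ => ?_)
      rw [norm_smul]
      exact mul_le_mul_of_nonneg_right (hC i z hz) (norm_nonneg _))
    (fun z hz => ha z hz) (fun z hz => hb z hz)
  rw [Complex.ofReal_re] at key
  exact key

/-- The power `x ^ z`, with value `0` at `x = 0` for every `z`. -/
noncomputable def supportCpow (x : ℝ) (z : ℂ) : ℂ :=
  if x = 0 then 0 else Complex.exp (z * Real.log x)

/-- The value `0` at `x = 0`, even for `z = 0`, keeps the function entire when eigenvalues vanish.
-/
lemma differentiable_supportCpow (x : ℝ) : Differentiable ℂ (supportCpow x) := by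
  by_cases hx : x = 0
  · have : supportCpow x = fun _ => 0 := by ext; simp [supportCpow, hx]
    rw [this]; fun_prop
  · have : supportCpow x = fun z => Complex.exp (z * Real.log x) := by
      ext; simp [supportCpow, hx]
    rw [this]; fun_prop

lemma norm_supportCpow_le {x : ℝ} {z : ℂ} (hz : z.re ∈ Set.Icc 0 1) :
    ‖supportCpow x z‖ ≤ Real.exp |Real.log x| := by
  by_cases hx : x = 0
  · simp [supportCpow, hx]
  · rw [supportCpow, if_neg hx, Complex.norm_exp, Real.exp_le_exp, Complex.re_mul_ofReal]
    refine (le_abs_self _).trans ?_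
    rw [abs_mul, abs_of_nonneg hz.1]
    exact mul_le_of_le_one_left (abs_nonneg _) hz.2

lemma supportCpow_eq_zero_or_norm_eq_one (x : ℝ) {z : ℂ} (hz : z.re = 0) :
    supportCpow x z = 0 ∨ ‖supportCpow x z‖ = 1 := by
  by_cases hx : x = 0
  · simp [supportCpow, hx]
  · right
    rw [supportCpow, if_neg hx, Complex.norm_exp, Complex.re_mul_ofReal, hz]
    simp

lemma supportCpow_add_one {x : ℝ} (hx : 0 ≤ x) (z : ℂ) :
    supportCpow x (z + 1) = supportCpow x z * x := by
  rcases hx.eq_or_lt with rfl | hx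
  · simp [supportCpow]
  · rw [supportCpow, supportCpow, if_neg hx.ne', if_neg hx.ne', add_mul, Complex.exp_add, one_mul,
      ← Complex.ofReal_exp, Real.exp_log hx]

lemma supportCpow_ofReal {x t : ℝ} (hx : 0 ≤ x) (ht : t ≠ 0) :
    supportCpow x t = ((x ^ t : ℝ) : ℂ) := by
  rcases hx.eq_or_lt with rfl | hx
  · simp [supportCpow, Real.zero_rpow ht]
  · rw [supportCpow, if_neg hx.ne', Real.rpow_def_of_pos hx]
    push_cast
    ring_nf

open Matrix

lemma diagonal_mem_unitaryGroup {n : ℕ} {d : Fin n → ℂ} (hd : ∀ i, ‖d i‖ = 1) :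
    diagonal d ∈ unitaryGroup (Fin n) ℂ := by
  rw [mem_unitaryGroup_iff, star_eq_conjTranspose, diagonal_conjTranspose, diagonal_mul_diagonal,
    ← diagonal_one]
  congr 1
  ext i
  simp [Complex.mul_conj, Complex.normSq_eq_norm_sq, hd]

/-- A diagonal matrix with entries in `{0} ∪ 𝕊¹` is the average of two unitary matrices. -/
lemma exists_unitary_diagonal_eq_average {n : ℕ} {d : Fin n → ℂ}
    (hd : ∀ i, d i = 0 ∨ ‖d i‖ = 1) :
    ∃ U ∈ unitaryGroup (Fin n) ℂ, ∃ V ∈ unitaryGroup (Fin n) ℂ,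
      diagonal d = (1 / 2 : ℂ) • (U + V) := by
  refine ⟨diagonal fun i => if d i = 0 then 1 else d i, diagonal_mem_unitaryGroup fun i => ?_,
    diagonal fun i => if d i = 0 then -1 else d i, diagonal_mem_unitaryGroup fun i => ?_, ?_⟩
  · rcases hd i with h | h
    · simp [h]
    · have : d i ≠ 0 := by rintro h0; simp [h0] at h
      simp [this, h]
  · rcases hd i with h | h
    · simp [h]
    · have : d i ≠ 0 := by rintro h0; simp [h0] at h
      simp [this, h]
  · rw [diagonal_add, ← diagonal_smul]
    congr 1
    ext i
    by_cases h : d i = 0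
    · simp [h]
    · simp [h]; ring

namespace IsUnitarilyInvariantNorm

variable {n : ℕ} {N : Seminorm ℂ (Matrix (Fin n) (Fin n) ℂ)}

/-- Imaginary powers of a singular matrix are only partial isometries; averaging two unitaries still
gives a contraction for `N`. -/
lemma diagonal_mul_le (hN : IsUnitarilyInvariantNorm N) {d : Fin n → ℂ}
    (hd : ∀ i, d i = 0 ∨ ‖d i‖ = 1) (M : Matrix (Fin n) (Fin n) ℂ) :
    N (diagonal d * M) ≤ N M := by
  obtain ⟨U, hU, V, hV, h⟩ := exists_unitary_diagonal_eq_average hd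
  have h1 := hN.unitary_mul_mul M U hU 1 (one_mem _)
  have h2 := hN.unitary_mul_mul M V hV 1 (one_mem _)
  rw [mul_one] at h1 h2
  rw [h, smul_mul_assoc, add_mul, map_smul_eq_mul]
  have := map_add_le_add N (U * M) (V * M)
  norm_num
  linarith

lemma mul_diagonal_le (hN : IsUnitarilyInvariantNorm N) {d : Fin n → ℂ}
    (hd : ∀ i, d i = 0 ∨ ‖d i‖ = 1) (M : Matrix (Fin n) (Fin n) ℂ) :
    N (M * diagonal d) ≤ N M := by
  obtain ⟨U, hU, V, hV, h⟩ := exists_unitary_diagonal_eq_average hd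
  have h1 := hN.unitary_mul_mul M 1 (one_mem _) U hU
  have h2 := hN.unitary_mul_mul M 1 (one_mem _) V hV
  rw [one_mul] at h1 h2
  rw [h, mul_smul_comm, mul_add, map_smul_eq_mul]
  have := map_add_le_add N (M * U) (M * V)
  norm_num
  linarith

lemma diagonal_rpow_mul_mul_le (hN : IsUnitarilyInvariantNorm N) {x y : Fin n → ℝ}
    (hx : ∀ i, 0 ≤ x i) (hy : ∀ i, 0 ≤ y i) (Y : Matrix (Fin n) (Fin n) ℂ) {t : ℝ}
    (ht₀ : 0 < t) (ht₁ : t < 1) :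
    N (diagonal (fun i => ((x i ^ (1 - t) : ℝ) : ℂ)) * Y * diagonal fun i => ((y i ^ t : ℝ) : ℂ)) ≤
      N (diagonal (fun i => (x i : ℂ)) * Y) ^ (1 - t) *
        N (Y * diagonal fun i => (y i : ℂ)) ^ t := by
  set F : ℂ → Matrix (Fin n) (Fin n) ℂ := fun z =>
    diagonal (fun i => supportCpow (x i) (1 - z)) * Y * diagonal fun i => supportCpow (y i) z
  -- Expansion in matrix units puts `F` in the form required by `sum_smul_le_interp`.
  have hF : ∀ z, F z = ∑ p : Fin n × Fin n,
      (supportCpow (x p.1) (1 - z) * supportCpow (y p.2) z) • single p.1 p.2 (Y p.1 p.2) := by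
    intro z
    rw [Fintype.sum_prod_type, matrix_eq_sum_single (F z)]
    refine Finset.sum_congr rfl fun i _ => Finset.sum_congr rfl fun j _ => ?_
    have : F z i j = supportCpow (x i) (1 - z) * supportCpow (y j) z * Y i j := by
      simp only [F, mul_diagonal, diagonal_mul]
      ring
    rw [this, smul_single, smul_eq_mul]
  have key := N.sum_smul_le_interp hN.eq_zero
    (fun (p : Fin n × Fin n) z => supportCpow (x p.1) (1 - z) * supportCpow (y p.2) z)
    (fun p => single p.1 p.2 (Y p.1 p.2))
    (fun p => Real.exp |Real.log (x p.1)| * Real.exp |Real.log (y p.2)|)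
    (a := N (diagonal (fun i => (x i : ℂ)) * Y)) (b := N (Y * diagonal fun i => (y i : ℂ)))
    (fun p => ((differentiable_supportCpow _).comp (by fun_prop)).mul
      (differentiable_supportCpow _))
    (fun p z hz => by
      have hz : z.re ∈ Set.Icc 0 1 := hz
      rw [norm_mul]
      refine mul_le_mul (norm_supportCpow_le ?_) (norm_supportCpow_le hz) (norm_nonneg _)
        (Real.exp_pos _).le
      simpa [and_comm] using hz)
    (t := t) ⟨ht₀.le, ht₁.le⟩
    (fun z hz => by
      rw [← hF]
      -- On `re z = 0`, splitting `1 - z = -z + 1` extracts `diagonal x * Y` and leaves imaginary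
      -- powers outside.
      have : F z =
          diagonal (fun i => supportCpow (x i) (-z)) * (diagonal (fun i => (x i : ℂ)) * Y) *
          diagonal fun i => supportCpow (y i) z := by
        simp only [F]
        rw [← mul_assoc, diagonal_mul_diagonal]
        simp only [← supportCpow_add_one (hx _), neg_add_eq_sub]
      rw [this]
      exact (hN.mul_diagonal_le (fun i => supportCpow_eq_zero_or_norm_eq_one _ hz) _).trans
        (hN.diagonal_mul_le (fun i => supportCpow_eq_zero_or_norm_eq_one _ (by simp [hz])) _))
    (fun z hz => by
      rw [← hF]
      have : F z = diagonal (fun i => supportCpow (x i) (1 - z)) *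
          (Y * diagonal (fun i => (y i : ℂ)) *
          diagonal fun i => supportCpow (y i) (z - 1)) := by
        simp only [F]
        rw [mul_assoc Y, diagonal_mul_diagonal, mul_assoc]
        simp only [mul_comm (Complex.ofReal (y _)), ← supportCpow_add_one (hy _), sub_add_cancel]
      rw [this]
      exact (hN.diagonal_mul_le
          (fun i => supportCpow_eq_zero_or_norm_eq_one _ (by simp [hz])) _).trans
        (hN.mul_diagonal_le (fun i => supportCpow_eq_zero_or_norm_eq_one _ (by simp [hz])) _))
  rw [← hF] at key
  convert key using 2
  simp only [F]
  congr 3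
  · ext i
    -- Needs `1 - t ≠ 0`: at exponent `0` and base `0` the two powers differ.
    rw [← supportCpow_ofReal (hx i) (by linarith)]
    push_cast
    rfl
  · ext i
    rw [supportCpow_ofReal (hy i) ht₀.ne']

lemma star_mul_mul (hN : IsUnitarilyInvariantNorm N) {U V : Matrix (Fin n) (Fin n) ℂ}
    (hU : U ∈ unitaryGroup (Fin n) ℂ) (hV : V ∈ unitaryGroup (Fin n) ℂ)
    (M : Matrix (Fin n) (Fin n) ℂ) : N (U * M * star V) = N M :=
  hN.unitary_mul_mul M U hU _ (Unitary.star_mem hV)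

end IsUnitarilyInvariantNorm

lemma matrixRpow_eq_mul_diagonal_mul {n : ℕ} {A : Matrix (Fin n) (Fin n) ℂ} (hA : A.IsHermitian)
    (t : ℝ) : matrixRpow A t = (hA.eigenvectorUnitary : Matrix (Fin n) (Fin n) ℂ) *
      diagonal (fun i => ((hA.eigenvalues i ^ t : ℝ) : ℂ)) *
      star (hA.eigenvectorUnitary : Matrix (Fin n) (Fin n) ℂ) := by
  rw [matrixRpow, hA.cfc_eq, IsHermitian.cfc, Unitary.conjStarAlgAut_apply]
  rfl

/-- Passing to eigenbases reduces this to diagonal matrices, with `Y = U* X V`. -/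
lemma IsUnitarilyInvariantNorm.matrixRpow_mul_mul_le {n : ℕ}
    {N : Seminorm ℂ (Matrix (Fin n) (Fin n) ℂ)} (hN : IsUnitarilyInvariantNorm N)
    {A B : Matrix (Fin n) (Fin n) ℂ} (hA : A.PosSemidef) (hB : B.PosSemidef)
    (X : Matrix (Fin n) (Fin n) ℂ) {t : ℝ} (ht₀ : 0 < t) (ht₁ : t < 1) :
    N (matrixRpow A (1 - t) * X * matrixRpow B t) ≤ N (A * X) ^ (1 - t) * N (X * B) ^ t := by
  have hU := hA.1.eigenvectorUnitary.2
  have hV := hB.1.eigenvectorUnitary.2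
  have hA' := hA.1.spectral_theorem
  have hB' := hB.1.spectral_theorem
  rw [Unitary.conjStarAlgAut_apply] at hA' hB'
  rw [matrixRpow_eq_mul_diagonal_mul hA.1, matrixRpow_eq_mul_diagonal_mul hB.1]
  set U : Matrix (Fin n) (Fin n) ℂ :=
    (hA.1.eigenvectorUnitary : Matrix (Fin n) (Fin n) ℂ)
  set V : Matrix (Fin n) (Fin n) ℂ :=
    (hB.1.eigenvectorUnitary : Matrix (Fin n) (Fin n) ℂ)
  have hUU : U * star U = 1 := mem_unitaryGroup_iff.1 hU
  have hVV : V * star V = 1 := mem_unitaryGroup_iff.1 hV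
  have key := hN.diagonal_rpow_mul_mul_le hA.eigenvalues_nonneg hB.eigenvalues_nonneg
    (star U * X * V) ht₀ ht₁
  rw [← hN.star_mul_mul hU hV, ← hN.star_mul_mul hU hV (_ * (star U * X * V)),
    ← hN.star_mul_mul hU hV (star U * X * V * _)] at key
  have h₁ : A * X = U * (diagonal (fun i => (hA.1.eigenvalues i : ℂ)) * (star U * X * V)) *
      star V := by
    calc A * X = U * diagonal (fun i => (hA.1.eigenvalues i : ℂ)) * star U * X * (V * star V) := by
          rw [hVV, mul_one]; exact congrArg (· * X) hA'
      _ = _ := by simp only [mul_assoc]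
  have h₂ : X * B = U * (star U * X * V * diagonal (fun i => (hB.1.eigenvalues i : ℂ))) *
      star V := by
    calc X * B = (U * star U) * X *
          (V * diagonal (fun i => (hB.1.eigenvalues i : ℂ)) * star V) := by
          rw [hUU, one_mul]; exact congrArg (X * ·) hB'
      _ = _ := by simp only [mul_assoc]
  rw [h₁, h₂]
  simpa only [mul_assoc] using key

/-- Young's inequality with the Kittaneh–Manasrah correction, for weights at most `1 / 2`. -/
lemma rpow_mul_rpow_add_sq_le {x y t : ℝ} (hx : 0 ≤ x) (hy : 0 ≤ y) (ht₀ : 0 ≤ t)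
    (ht : t ≤ 1 / 2) :
    x ^ (1 - t) * y ^ t + t * (√x - √y) ^ 2 ≤ (1 - t) * x + t * y := by
  -- The claim is AM-GM for `x` and `√(xy)`, because `(1-t)x + ty - t(√x - √y)² = (1-2t)x +
  -- 2t√(xy)`.
  have h := Real.geom_mean_le_arith_mean2_weighted (w₁ := 1 - 2 * t) (w₂ := 2 * t)
    (by linarith) (by linarith) hx (Real.sqrt_nonneg (x * y)) (by ring)
  have h' : √(x * y) ^ (2 * t) = x ^ t * y ^ t := by
    rw [Real.rpow_mul (Real.sqrt_nonneg _), Real.rpow_two, Real.sq_sqrt (mul_nonneg hx hy),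
      Real.mul_rpow hx hy]
  rw [h', ← mul_assoc, ← Real.rpow_add_of_nonneg hx (by linarith) ht₀, Real.sqrt_mul hx] at h
  have e : 1 - 2 * t + t = 1 - t := by ring
  rw [e] at h
  have := Real.sq_sqrt hx
  have := Real.sq_sqrt hy
  nlinarith

lemma rpow_mul_rpow_add_min_mul_sq_le {x y t : ℝ} (hx : 0 ≤ x) (hy : 0 ≤ y) (ht₀ : 0 ≤ t)
    (ht₁ : t ≤ 1) :
    x ^ (1 - t) * y ^ t + min t (1 - t) * (√x - √y) ^ 2 ≤ (1 - t) * x + t * y := by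
  rcases le_total t (1 / 2) with h | h
  · rw [min_eq_left (by linarith)]
    exact rpow_mul_rpow_add_sq_le hx hy ht₀ h
  · rw [min_eq_right (by linarith)]
    have := rpow_mul_rpow_add_sq_le hy hx (t := 1 - t) (by linarith) (by linarith)
    rw [sub_sub_cancel] at this
    rw [sub_sq_comm, mul_comm (x ^ (1 - t))]
    linarith

lemma rpow_mul_rpow_add_min_mul_sq_fourth_root_le {a b ν : ℝ} (ha : 0 ≤ a) (hb : 0 ≤ b)
    (hν₀ : 0 ≤ ν) (hν₁ : ν ≤ 1 / 2) :
    a ^ (1 - ν) * b ^ ν + min (2 * ν) (1 - 2 * ν) * (√a - (a * b) ^ (1 / 4 : ℝ)) ^ 2 ≤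
      (1 - 2 * ν) * a + 2 * ν * √(a * b) := by
  have hab := mul_nonneg ha hb
  have h := rpow_mul_rpow_add_min_mul_sq_le ha (Real.sqrt_nonneg (a * b)) (t := 2 * ν)
    (by linarith) (by linarith)
  have h₁ : √(a * b) ^ (2 * ν) = a ^ ν * b ^ ν := by
    rw [Real.rpow_mul (Real.sqrt_nonneg _), Real.rpow_two, Real.sq_sqrt hab,
      Real.mul_rpow ha hb]
  have h₂ : √√(a * b) = (a * b) ^ (1 / 4 : ℝ) := by
    rw [Real.sqrt_eq_rpow, Real.sqrt_eq_rpow, ← Real.rpow_mul hab]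
    norm_num
  have e : 1 - 2 * ν + ν = 1 - ν := by ring
  rwa [h₁, h₂, ← mul_assoc, ← Real.rpow_add_of_nonneg ha (by linarith) hν₀, e] at h


theorem proposition3p14 {n : ℕ} (N : Seminorm ℂ (Matrix (Fin n) (Fin n) ℂ))
    (hN : IsUnitarilyInvariantNorm N)
    (A B X : Matrix (Fin n) (Fin n) ℂ) (hA : A.PosSemidef) (hB : B.PosSemidef)
    (ν r r₀ : ℝ) (hν₀ : 0 < ν) (hν₁ : ν ≤ 1 / 2)
    (hr : r = min ν (1 - ν)) (hr₀ : r₀ = min (2 * r) (1 - 2 * r)) :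
    N (matrixRpow A (1 - ν) * X * matrixRpow B ν + matrixRpow A ν * X * matrixRpow B (1 - ν)) ≤
      (1 - 2 * ν) * (N (A * X) + N (X * B)) +
        (2 * (2 * ν * √(N (A * X) * N (X * B))) -
          r₀ * ((√(N (A * X)) - (N (A * X) * N (X * B)) ^ (1 / 4 : ℝ)) ^ 2 +
            (√(N (X * B)) - (N (A * X) * N (X * B)) ^ (1 / 4 : ℝ)) ^ 2)) := by
  have ha : 0 ≤ N (A * X) := apply_nonneg N _
  have hb : 0 ≤ N (X * B) := apply_nonneg N _
  have h₁ := hN.matrixRpow_mul_mul_le hA hB X hν₀ (by linarith)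
  have h₂ := hN.matrixRpow_mul_mul_le hA hB X (t := 1 - ν) (by linarith) (by linarith)
  rw [sub_sub_cancel] at h₂
  have h₃ := rpow_mul_rpow_add_min_mul_sq_fourth_root_le ha hb hν₀.le hν₁
  have h₄ := rpow_mul_rpow_add_min_mul_sq_fourth_root_le hb ha hν₀.le hν₁
  rw [mul_comm (N (X * B)) (N (A * X))] at h₄
  rw [min_eq_left (by linarith)] at hr
  subst hr
  rw [← hr₀] at h₃ h₄
  have := map_add_le_add N (matrixRpow A (1 - r) * X * matrixRpow B r)
    (matrixRpow A r * X * matrixRpow B (1 - r))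
  linarith
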